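/- Let $n$ be a nonnegative integer. The hypercube $H(n)$ is the graph with vertex set $\mathbb{Z}_2^n$ in which two vertices are adjacent if and only if they differ in exactly one coordinate. For $0\le s\le n$ let $U_s(n)$ be the eigenspace of the adjacency matrix of $H(n)$, acting on real-valued functions on $\mathbb{Z}_2^n$, for the eigenvalue $n-2s$, and for $0\le i\le j\le n$ put $U_{[i,j]}(n)=U_i(n)\oplus U_{i+1}(n)\oplus\cdots\oplus U_j(n)$. For $f:\mathbb{Z}_2^n\to\mathbb{R}$ let $|f|$ be the number of $x$ with $f(x)\neq 0$. Functions $f,g:\mathbb{Z}_2^n\to\mathbb{R}$ are called equivalent if there are an automorphism $\pi$ of the graph $H(n)$ and a real constant $c\ne 0$ such that $g(x)=c\,f(\pi(x))$ for all $x$. For $k\ge 1$ define functions on $\mathbb{Z}_2^k$ as follows: $\varphi_k$ takes the value $1$ at the all-zeros vector, $-1$ at the all-ones vector and $0$ elsewhere; $\psi_k$ takes the value $1$ at the all-zeros vector and at the all-ones vector and $0$ elsewhere; $I_k$ takes the value $1$ at the all-zeros vector and $0$ elsewhere. Let $I_0$ be the constant $1$ on the one-point set $\mathbb{Z}_2^0$.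 For functions $f_1$ on $\mathbb{Z}_2^a$ and $f_2$ on $\mathbb{Z}_2^b$ let $(f_1\otimes f_2)(x,y)=f_1(x)f_2(y)$, a function on $\mathbb{Z}_2^{a+b}=\mathbb{Z}_2^a\times\mathbb{Z}_2^b$ (an empty tensor product is the constant $1$ on $\mathbb{Z}_2^0$). **Theorem.** Let $0\le i\le j\le n$ and let $f\in U_{[i,j]}(n)$. 1. Suppose that $i+j\ge n$. Then $|f|=2^i$ if and only if $f$ is equivalent to a function $$\varphi_{n_1}\otimes\cdots\otimes\varphi_{n_k}\otimes\varphi_{m_1}\otimes\cdots\otimes\varphi_{m_\ell}\otimes I_r,$$ where $k,\ell,r$ are nonnegative integers, $n_1,\dots,n_k$ are odd positive integers, $m_1,\dots,m_\ell$ are even positive integers, $n=n_1+\cdots+n_k+m_1+\cdots+m_\ell+r$, $k+\ell=i$ and $\ell\ge n-j$. 2. Suppose that $i+j\le n$. Then $|f|=2^{n-j}$ if and only if $f$ is equivalent to a function $$\psi_{n_1}\otimes\cdots\otimes\psi_{n_k}\otimes\varphi_{m_1}\otimes\cdots\otimes\varphi_{m_\ell}\otimes I_r,$$ where $k,\ell,r$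 are nonnegative integers, $n_1,\dots,n_k$ are odd positive integers, $m_1,\dots,m_\ell$ are even positive integers, $n=n_1+\cdots+n_k+m_1+\cdots+m_\ell+r$, $k+\ell=n-j$ and $\ell\ge i$. -/

import Mathlib

/-- The `n`-dimensional hypercube `H(n)`: the vertices are the vectors of `ℤ₂ⁿ`, and two vertices
are adjacent if and only if they differ in exactly one coordinate. -/
def hypercube (n : ℕ) : SimpleGraph (Fin n → ZMod 2) where
  Adj x y := hammingDist x y = 1
  symm := ⟨fun x y h => by rwa [hammingDist_comm]⟩
  loopless := ⟨fun x h => by simp at h⟩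

instance hypercube_decidableRel (n : ℕ) : DecidableRel (hypercube n).Adj :=
  fun x y => inferInstanceAs (Decidable (hammingDist x y = 1))

/-- `U_i(n)`: the eigenspace of the adjacency matrix of `H(n)` for the eigenvalue `n - 2i`. -/
noncomputable def cubeEigenspace (n i : ℕ) : Submodule ℝ ((Fin n → ZMod 2) → ℝ) :=
  Module.End.eigenspace (Matrix.toLin' ((hypercube n).adjMatrix ℝ)) ((n : ℝ) - 2 * (i : ℝ))

theorem mem_cubeEigenspace_iff (n i : ℕ) (f : (Fin n → ZMod 2) → ℝ) :
    f ∈ cubeEigenspace n i ↔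
      ∀ x, ((n : ℝ) - 2 * (i : ℝ)) * f x = ∑ y ∈ (hypercube n).neighborFinset x, f y := by
  rw [cubeEigenspace, Module.End.mem_eigenspace_iff, funext_iff]
  refine forall_congr' fun x => ?_
  rw [Matrix.toLin'_apply, SimpleGraph.adjMatrix_mulVec_apply, Pi.smul_apply, smul_eq_mul]
  exact eq_comm

/-- `U_{[i,j]}(n) = U_i(n) ⊕ U_{i+1}(n) ⊕ ⋯ ⊕ U_j(n)`. -/
noncomputable def cubeEigenspaceIcc (n i j : ℕ) : Submodule ℝ ((Fin n → ZMod 2) → ℝ) :=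
  ⨆ s ∈ Finset.Icc i j, cubeEigenspace n s

/-- The sum in the definition of `U_{[i,j]}(n)` is direct. -/
theorem iSupIndep_cubeEigenspace (n : ℕ) : iSupIndep (cubeEigenspace n) := by
  have hinj : Function.Injective fun i : ℕ => (n : ℝ) - 2 * (i : ℝ) := by
    intro a b h
    have h' : (a : ℝ) = b := by
      simp only at h
      linarith
    exact_mod_cast h'
  exact (Module.End.eigenspaces_iSupIndep
    (Matrix.toLin' ((hypercube n).adjMatrix ℝ))).comp hinj

/-- Two functions on `H(n)` are equivalent if `g = c • (f ∘ π)` for an automorphism `π` of `H(n)`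
and a nonzero real constant `c`. -/
def CubeEquivalent {n : ℕ} (f g : (Fin n → ZMod 2) → ℝ) : Prop :=
  ∃ (π : hypercube n ≃g hypercube n) (c : ℝ), c ≠ 0 ∧ ∀ x, g x = c * f (π x)

/-- `φ_k`: the value is `1` at the all-zeros vector, `-1` at the all-ones vector, and `0` elsewhere
(used for `k ≥ 1`). -/
def cubePhi (k : ℕ) (x : Fin k → ZMod 2) : ℝ :=
  if x = 0 then 1 else if x = 1 then -1 else 0

/-- `ψ_k`: the value is `1` at the all-zeros and the all-ones vector, and `0` elsewhere
(used for `k ≥ 1`). -/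
def cubePsi (k : ℕ) (x : Fin k → ZMod 2) : ℝ :=
  if x = 0 then 1 else if x = 1 then 1 else 0

/-- `I_k`: the value is `1` at the all-zeros vector and `0` elsewhere. The function `I_0` is the
constant `1` on the only vertex of `H(0)`, hence a neutral factor of the tensor product. -/
def cubeI (k : ℕ) (x : Fin k → ZMod 2) : ℝ :=
  if x = 0 then 1 else 0

/-- The tensor product `(f ⊗ g)(x, y) = f(x) g(y)`, where `ℤ₂ᵃ × ℤ₂ᵇ` is identified with `ℤ₂ᵃ⁺ᵇ`
by concatenation. -/
def cubeTensor {a b : ℕ} (f : (Fin a → ZMod 2) → ℝ) (g : (Fin b → ZMod 2) → ℝ)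
    (x : Fin (a + b) → ZMod 2) : ℝ :=
  f (fun t => x (Fin.castAdd b t)) * g (fun t => x (Fin.natAdd a t))

/-- For a family of functions `F k` on `H(k)` and a list `[a₁, …, a_s]`, the tensor product
`F a₁ ⊗ ⋯ ⊗ F a_s`; the empty product is the constant `1` on `H(0)`. -/
def cubeTensorList (F : (k : ℕ) → (Fin k → ZMod 2) → ℝ) :
    (L : List ℕ) → (Fin L.sum → ZMod 2) → ℝ
  | [] => fun _ => 1
  | a :: L => cubeTensor (F a) (cubeTensorList F L)

/-- A function on `H(m)` regarded as a function on `H(n)`, where `n = m`. -/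
def cubeCast {m n : ℕ} (h : n = m) (f : (Fin m → ZMod 2) → ℝ) (x : Fin n → ZMod 2) : ℝ :=
  f (fun t => x (Fin.cast h.symm t))

/-! The characters of `ℤ₂ⁿ` diagonalise the adjacency matrix, so `f` has Fourier coefficients only
in weights from `i` to `j`. The lower end `i` enters through `SubcubeSumsVanish`: the indicator of a
subcube of codimension less than `i` involves only characters of weight less than `i`, hence is
orthogonal to `f`. Cutting the cube along one coordinate, the sum of the two halves keeps this
property and each half keeps it with `i` lowered by one. Induction on `n` gives `|f| ≥ 2^i`
(`SubcubeSumsVanish.two_pow_le`).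

Following the same induction in the equality case shows that, up to translation and scaling, `f`
lives on the points constant on each of `i` disjoint blocks of coordinates and zero elsewhere, with
alternating signs (`SubcubeSumsVanish.exists_isAlternatingOn`). Permuting coordinates so that blocks
become intervals gives the tensor product of the `φ`'s and `I_r`.

The upper end `j` bounds the number of even blocks. A `φ` on an odd block has a nonzero coefficient
of full weight, on an even block one of weight one less, so the product has one of weight `n - ℓ`,
whence `ℓ ≥ n - j`.

The second statement follows by multiplying with the parity character, which exchanges `U_s` and
`U_{n-s}`, fixes even `φ`'s and `I_r`, and turns odd `φ`'s into `ψ`'s. Both converses only count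
supports. -/

/-! ### Characters and the Fourier support of eigenfunctions. -/

/-- The sign `(-1)^b` of a bit. -/
def bitSign (b : ZMod 2) : ℝ := if b = 0 then 1 else -1

theorem zmod_two_cases (b : ZMod 2) : b = 0 ∨ b = 1 := by
  revert b; decide

@[simp] theorem bitSign_zero : bitSign 0 = 1 := by simp [bitSign]

@[simp] theorem bitSign_one : bitSign 1 = -1 := by simp [bitSign]

theorem bitSign_add (a b : ZMod 2) : bitSign (a + b) = bitSign a * bitSign b := by
  have h : (1 + 1 : ZMod 2) = 0 := by decide
  rcases zmod_two_cases a with rfl | rfl <;> rcases zmod_two_cases b with rfl | rfl <;>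
    simp [h]

theorem bitSign_mul_self (b : ZMod 2) : bitSign b * bitSign b = 1 := by
  rcases zmod_two_cases b with rfl | rfl <;> simp

theorem bitSign_ne_zero (b : ZMod 2) : bitSign b ≠ 0 := by
  rcases zmod_two_cases b with rfl | rfl <;> simp

/-- The character of `ℤ₂ⁿ` indexed by a set of coordinates. -/
def cubeChar {n : ℕ} (T : Finset (Fin n)) (x : Fin n → ZMod 2) : ℝ := ∏ t ∈ T, bitSign (x t)

theorem cubeChar_add {n : ℕ} (T : Finset (Fin n)) (x y : Fin n → ZMod 2) :
    cubeChar T (x + y) = cubeChar T x * cubeChar T y := by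
  simp [cubeChar, bitSign_add, Finset.prod_mul_distrib]

theorem cubeChar_ne_zero {n : ℕ} (T : Finset (Fin n)) (x : Fin n → ZMod 2) :
    cubeChar T x ≠ 0 :=
  Finset.prod_ne_zero_iff.2 fun _ _ => bitSign_ne_zero _

theorem cubeChar_single {n : ℕ} (T : Finset (Fin n)) (t : Fin n) :
    cubeChar T (Pi.single t 1) = if t ∈ T then -1 else 1 := by
  have h : ∀ s, bitSign ((Pi.single t 1 : Fin n → ZMod 2) s) = if s = t then -1 else 1 := by
    intro s
    by_cases hs : s = t
    · subst hs; simp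
    · simp [hs]
  simp [cubeChar, h, Finset.prod_ite_eq']

theorem hypercube_adj_iff {n : ℕ} (x y : Fin n → ZMod 2) :
    (hypercube n).Adj x y ↔ ∃ t, y = x + Pi.single t 1 := by
  have hz : ∀ a b : ZMod 2, a ≠ b ↔ b = a + 1 := by decide
  change hammingDist x y = 1 ↔ _
  rw [hammingDist, Finset.card_eq_one]
  refine exists_congr fun t => ?_
  rw [Finset.ext_iff, funext_iff]
  refine forall_congr' fun s => ?_
  by_cases hs : s = t
  · subst hs; simp [hz]
  · simp [hs, eq_comm]

theorem sum_neighborFinset_hypercube {n : ℕ} (g : (Fin n → ZMod 2) → ℝ) (x : Fin n → ZMod 2) :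
    ∑ y ∈ (hypercube n).neighborFinset x, g y = ∑ t, g (x + Pi.single t 1) := by
  symm
  refine Finset.sum_bij (fun t _ => x + Pi.single t 1) ?_ ?_ ?_ ?_
  · intro t _
    rw [SimpleGraph.mem_neighborFinset, hypercube_adj_iff]
    exact ⟨t, rfl⟩
  · intro s _ t _ h
    by_contra hst
    have := congrFun (add_left_cancel h) s
    simp [hst] at this
  · intro y hy
    rw [SimpleGraph.mem_neighborFinset, hypercube_adj_iff] at hy
    obtain ⟨t, rfl⟩ := hy
    exact ⟨t, Finset.mem_univ _, rfl⟩
  · intro t _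
    rfl

theorem mem_cubeEigenspace_iff_sum {n i : ℕ} {f : (Fin n → ZMod 2) → ℝ} :
    f ∈ cubeEigenspace n i ↔
      ∀ x, ((n : ℝ) - 2 * (i : ℝ)) * f x = ∑ t, f (x + Pi.single t 1) := by
  simp only [mem_cubeEigenspace_iff, sum_neighborFinset_hypercube]

theorem sum_ite_mem_neg_one {n : ℕ} (T : Finset (Fin n)) :
    (∑ t, if t ∈ T then (-1 : ℝ) else 1) = n - 2 * T.card := by
  have h : ∀ t : Fin n, (if t ∈ T then (-1 : ℝ) else 1) = 1 - 2 * if t ∈ T then 1 else 0 := by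
    intro t; split_ifs <;> norm_num
  simp only [h, Finset.sum_sub_distrib, ← Finset.mul_sum]
  simp

/-- Moving the shift by a unit vector from `f` onto the character shows that the same sum is scaled
equally by `n - 2s` and by `n - 2|T|`, which differ. -/
theorem sum_mul_cubeChar_eq_zero {n s : ℕ} {f : (Fin n → ZMod 2) → ℝ}
    (hf : f ∈ cubeEigenspace n s) {T : Finset (Fin n)} (hT : T.card ≠ s) :
    ∑ x, f x * cubeChar T x = 0 := by
  rw [mem_cubeEigenspace_iff_sum] at hf
  have key : ((n : ℝ) - 2 * s) * ∑ x, f x * cubeChar T x =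
      (n - 2 * T.card) * ∑ x, f x * cubeChar T x := by
    calc ((n : ℝ) - 2 * s) * ∑ x, f x * cubeChar T x
        = ∑ x, ∑ t, f (x + Pi.single t 1) * cubeChar T x := by
          simp only [Finset.mul_sum, ← mul_assoc, hf, Finset.sum_mul]
      _ = ∑ t, ∑ x, f (x + Pi.single t 1) * cubeChar T x := Finset.sum_comm
      _ = ∑ t, (if t ∈ T then (-1 : ℝ) else 1) * ∑ x, f x * cubeChar T x := by
          refine Finset.sum_congr rfl fun t _ => ?_
          rw [← Equiv.sum_comp (Equiv.addRight (Pi.single t (1 : ZMod 2)))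
            (fun x => f x * cubeChar T x), Finset.mul_sum]
          refine Finset.sum_congr rfl fun x _ => ?_
          simp only [Equiv.coe_addRight, cubeChar_add, cubeChar_single]
          split_ifs <;> ring
      _ = _ := by rw [← Finset.sum_mul, sum_ite_mem_neg_one]
  have hne : ((n : ℝ) - 2 * s) - (n - 2 * T.card) ≠ 0 := by
    have : (T.card : ℝ) ≠ s := by exact_mod_cast hT
    intro h
    apply this
    linarith
  have : (((n : ℝ) - 2 * s) - (n - 2 * T.card)) * ∑ x, f x * cubeChar T x = 0 := by
    rw [sub_mul, key, sub_self]
  exact (mul_eq_zero.1 this).resolve_left hne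

theorem cubeEigenspaceIcc_le {n i j : ℕ} {V : Submodule ℝ ((Fin n → ZMod 2) → ℝ)}
    (h : ∀ s, i ≤ s → s ≤ j → cubeEigenspace n s ≤ V) : cubeEigenspaceIcc n i j ≤ V :=
  iSup₂_le fun s hs => h s (Finset.mem_Icc.1 hs).1 (Finset.mem_Icc.1 hs).2

theorem cubeEigenspace_le_Icc {n i j s : ℕ} (hi : i ≤ s) (hj : s ≤ j) :
    cubeEigenspace n s ≤ cubeEigenspaceIcc n i j :=
  le_iSup₂_of_le s (Finset.mem_Icc.2 ⟨hi, hj⟩) le_rfl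

theorem sum_mul_cubeChar_eq_zero_of_mem_Icc {n i j : ℕ} {f : (Fin n → ZMod 2) → ℝ}
    (hf : f ∈ cubeEigenspaceIcc n i j) {T : Finset (Fin n)} (hT : T.card < i ∨ j < T.card) :
    ∑ x, f x * cubeChar T x = 0 := by
  let φ : ((Fin n → ZMod 2) → ℝ) →ₗ[ℝ] ℝ :=
    ∑ x, (cubeChar T x) • (LinearMap.proj x : ((Fin n → ZMod 2) → ℝ) →ₗ[ℝ] ℝ)
  have hφ : ∀ g, φ g = ∑ x, g x * cubeChar T x := by
    intro g
    simp [φ, mul_comm]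
  have hle : cubeEigenspaceIcc n i j ≤ LinearMap.ker φ := by
    refine cubeEigenspaceIcc_le fun s hi hj g hg => ?_
    rw [LinearMap.mem_ker, hφ]
    exact sum_mul_cubeChar_eq_zero hg (by omega)
  rw [← hφ]
  exact hle hf

/-! ### Automorphisms and the parity twist. -/

theorem comp_iso_mem_cubeEigenspaceIcc {n i j : ℕ} {f : (Fin n → ZMod 2) → ℝ}
    (hf : f ∈ cubeEigenspaceIcc n i j) (π : hypercube n ≃g hypercube n) :
    (fun x => f (π x)) ∈ cubeEigenspaceIcc n i j := by
  have hle : cubeEigenspaceIcc n i j ≤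
      (cubeEigenspaceIcc n i j).comap (LinearMap.funLeft ℝ ℝ π) := by
    refine cubeEigenspaceIcc_le fun s hi hj g hg => ?_
    refine cubeEigenspace_le_Icc hi hj ?_
    rw [mem_cubeEigenspace_iff] at hg ⊢
    intro x
    rw [LinearMap.funLeft_apply, hg]
    symm
    refine Finset.sum_bij (fun y _ => π y) ?_ ?_ ?_ ?_
    · intro y hy
      rw [SimpleGraph.mem_neighborFinset] at hy ⊢
      exact π.map_adj_iff.2 hy
    · intro y _ z _ h
      exact π.injective h
    · intro y hy
      refine ⟨π.symm y, ?_, by simp⟩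
      rw [SimpleGraph.mem_neighborFinset] at hy ⊢
      rw [← π.map_adj_iff]
      simpa using hy
    · intro y _
      rfl
  exact hle hf

/-- The parity character `x ↦ (-1)^{|x|}`. -/
def cubeParity {n : ℕ} (x : Fin n → ZMod 2) : ℝ := ∏ t, bitSign (x t)

theorem cubeParity_ne_zero {n : ℕ} (x : Fin n → ZMod 2) : cubeParity x ≠ 0 :=
  cubeChar_ne_zero Finset.univ x

theorem cubeParity_add_single {n : ℕ} (x : Fin n → ZMod 2) (t : Fin n) :
    cubeParity (x + Pi.single t 1) = -cubeParity x := by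
  have := cubeChar_add Finset.univ x (Pi.single t 1)
  rw [cubeChar_single, if_pos (Finset.mem_univ t)] at this
  simpa [cubeChar, cubeParity] using this

/-- Parity changes sign along every edge, so the twist negates eigenvalues, and `-(n - 2s) = n - 2(n
- s)`. -/
theorem cubeParity_mul_mem_cubeEigenspaceIcc {n i j : ℕ} (hjn : j ≤ n)
    {f : (Fin n → ZMod 2) → ℝ} (hf : f ∈ cubeEigenspaceIcc n i j) :
    (fun x => cubeParity x * f x) ∈ cubeEigenspaceIcc n (n - j) (n - i) := by
  have hle : cubeEigenspaceIcc n i j ≤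
      (cubeEigenspaceIcc n (n - j) (n - i)).comap (LinearMap.mulLeft ℝ cubeParity) := by
    refine cubeEigenspaceIcc_le fun s hi hj g hg => ?_
    refine cubeEigenspace_le_Icc (s := n - s) (by omega) (by omega) ?_
    rw [mem_cubeEigenspace_iff_sum] at hg ⊢
    intro x
    have hs : ((n - s : ℕ) : ℝ) = n - s := Nat.cast_sub (hj.trans hjn)
    simp only [LinearMap.mulLeft_apply, Pi.mul_apply, cubeParity_add_single, hs,
      ← Finset.mul_sum, ← hg]
    ring
  exact hle hf

theorem eq_of_invariant_add_single {n : ℕ} {h : (Fin n → ZMod 2) → ℝ}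
    (hh : ∀ x t, h (x + Pi.single t 1) = h x) (x : Fin n → ZMod 2) : h x = h 0 := by
  have key : ∀ s : Finset (Fin n), h (∑ t ∈ s, Pi.single t (x t)) = h 0 := by
    intro s
    induction s using Finset.induction_on with
    | empty => simp
    | insert t s ht ih =>
      rw [Finset.sum_insert ht, add_comm]
      rcases zmod_two_cases (x t) with h0 | h1
      · simpa [h0] using ih
      · rw [h1, hh, ih]
  rw [← key Finset.univ, Finset.univ_sum_single]

/-- Both factors change sign along every edge, so their product is constant; its value is read off
at `0`. -/
theorem cubeParity_mul_iso {n : ℕ} (π : hypercube n ≃g hypercube n) (x : Fin n → ZMod 2) :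
    cubeParity x * cubeParity (π x) = cubeParity (π 0) := by
  have h0 : cubeParity (0 : Fin n → ZMod 2) = 1 := by simp [cubeParity]
  have := eq_of_invariant_add_single (h := fun x => cubeParity x * cubeParity (π x)) ?_ x
  · simpa [h0] using this
  · intro y t
    have hadj : (hypercube n).Adj (π y) (π (y + Pi.single t 1)) :=
      π.map_adj_iff.2 ((hypercube_adj_iff _ _).2 ⟨t, rfl⟩)
    obtain ⟨s, hs⟩ := (hypercube_adj_iff _ _).1 hadj
    simp only [hs, cubeParity_add_single]
    ring

/-! ### Vanishing subcube sums and the lower bound on the support. -/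

/-- The sums of `f` over all subcubes of codimension less than `i` vanish. -/
def SubcubeSumsVanish {n : ℕ} (i : ℕ) (f : (Fin n → ZMod 2) → ℝ) : Prop :=
  ∀ (S : Finset (Fin n)) (v : Fin n → ZMod 2), S.card < i →
    ∑ x, (if ∀ t ∈ S, x t = v t then f x else 0) = 0

/-- The indicator of a subcube fixing the coordinates in `S` is a product of factors `(1 ± bitSign)
/ 2`; expanded, it uses only characters of subsets of `S`. -/
theorem subcubeSumsVanish_of_mem_cubeEigenspaceIcc {n i j : ℕ} {f : (Fin n → ZMod 2) → ℝ}
    (hf : f ∈ cubeEigenspaceIcc n i j) : SubcubeSumsVanish i f := by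
  intro S v hS
  have hbit : ∀ a b : ZMod 2, (if a = b then (1 : ℝ) else 0) =
      (1 / 2) * (1 + bitSign b * bitSign a) := by
    intro a b
    rcases zmod_two_cases a with rfl | rfl <;> rcases zmod_two_cases b with rfl | rfl <;>
      norm_num
  have hind : ∀ x : Fin n → ZMod 2, (if ∀ t ∈ S, x t = v t then f x else 0) =
      ∑ T ∈ S.powerset, (1 / 2) ^ S.card * cubeChar T v * (f x * cubeChar T x) := by
    intro x
    have h1 : (if ∀ t ∈ S, x t = v t then f x else 0) =
        f x * ∏ t ∈ S, (if x t = v t then (1 : ℝ) else 0) := by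
      rw [Finset.prod_ite_zero]
      simp
    rw [h1]
    simp only [hbit]
    rw [Finset.prod_mul_distrib, Finset.prod_const, Finset.prod_one_add, Finset.mul_sum,
      Finset.mul_sum]
    refine Finset.sum_congr rfl fun T _ => ?_
    rw [Finset.prod_mul_distrib, cubeChar, cubeChar]
    ring
  simp only [hind]
  rw [Finset.sum_comm]
  refine Finset.sum_eq_zero fun T hT => ?_
  rw [← Finset.mul_sum, sum_mul_cubeChar_eq_zero_of_mem_Icc hf (Or.inl ?_), mul_zero]
  exact (Finset.card_le_card (Finset.mem_powerset.1 hT)).trans_lt hS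

theorem sum_cube_succ {n : ℕ} (f : (Fin (n + 1) → ZMod 2) → ℝ) :
    ∑ x, f x = ∑ y, f (Fin.cons 0 y) + ∑ y, f (Fin.cons 1 y) := by
  rw [← Equiv.sum_comp (Fin.consEquiv fun _ => ZMod 2), Fintype.sum_prod_type]
  exact Fin.sum_univ_two _

/-- A subcube of the smaller cube lifts with coordinate `0` left free, at the same codimension. -/
theorem SubcubeSumsVanish.halves_add {n i : ℕ} {f : (Fin (n + 1) → ZMod 2) → ℝ}
    (hf : SubcubeSumsVanish i f) :
    SubcubeSumsVanish i (fun y => f (Fin.cons 0 y) + f (Fin.cons 1 y)) := by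
  intro S v hS
  have := hf (S.map (Fin.succEmb n)) (Fin.cons 0 v) (by simpa using hS)
  rw [sum_cube_succ, ← Finset.sum_add_distrib] at this
  refine Eq.trans (Finset.sum_congr rfl fun y _ => ?_) this
  simp only [Finset.mem_map, forall_exists_index, and_imp, forall_apply_eq_imp_iff₂,
    Fin.coe_succEmb, Fin.cons_succ]
  split_ifs <;> simp

/-- Fixing coordinate `0` as well costs one codimension. -/
theorem SubcubeSumsVanish.half {n i : ℕ} {f : (Fin (n + 1) → ZMod 2) → ℝ}
    (hf : SubcubeSumsVanish (i + 1) f) (b : ZMod 2) :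
    SubcubeSumsVanish i (fun y => f (Fin.cons b y)) := by
  intro S v hS
  have := hf (insert 0 (S.map (Fin.succEmb n))) (Fin.cons b v)
    ((Finset.card_insert_le _ _).trans_lt (by simpa using hS))
  rw [sum_cube_succ] at this
  simp only [Finset.mem_insert, Finset.mem_map, forall_eq_or_imp, forall_exists_index, and_imp,
    forall_apply_eq_imp_iff₂, Fin.coe_succEmb, Fin.cons_succ, Fin.cons_zero] at this
  rcases zmod_two_cases b with rfl | rfl <;> simpa using this

theorem ncard_support_cube_succ {n : ℕ} (f : (Fin (n + 1) → ZMod 2) → ℝ) :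
    (Function.support f).ncard = (Function.support fun y => f (Fin.cons 0 y)).ncard +
      (Function.support fun y => f (Fin.cons 1 y)).ncard := by
  let e : ZMod 2 → (Fin n → ZMod 2) → (Fin (n + 1) → ZMod 2) := fun b y => Fin.cons b y
  have hinj : ∀ b : ZMod 2, Function.Injective (e b) :=
    fun b => Fin.cons_right_injective (α := fun _ : Fin (n + 1) => ZMod 2) b
  have hU : Function.support f =
      e 0 ''
        (Function.support fun y => f (Fin.cons 0 y)) ∪
      e 1 ''
        (Function.support fun y => f (Fin.cons 1 y)) := by
    ext x
    simp only [Set.mem_union, Set.mem_image, Function.mem_support]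
    constructor
    · intro hx
      induction x using Fin.consCases with
      | _ b y =>
        rcases zmod_two_cases b with rfl | rfl
        · exact Or.inl ⟨y, hx, rfl⟩
        · exact Or.inr ⟨y, hx, rfl⟩
    · rintro (⟨y, hy, rfl⟩ | ⟨y, hy, rfl⟩) <;> exact hy
  rw [hU, Set.ncard_union_eq ?_ (Set.toFinite _) (Set.toFinite _),
    Set.ncard_image_of_injective _ (hinj 0), Set.ncard_image_of_injective _ (hinj 1)]
  rw [Set.disjoint_left]
  rintro _ ⟨y, _, rfl⟩ ⟨z, _, h⟩
  have := congrFun h 0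
  simp [e] at this

theorem fun_eq_zero_of_halves {n : ℕ} {f : (Fin (n + 1) → ZMod 2) → ℝ}
    (h0 : (fun y => f (Fin.cons 0 y)) = 0) (h1 : (fun y => f (Fin.cons 1 y)) = 0) : f = 0 := by
  funext x
  induction x using Fin.consCases with
  | _ b y =>
    rcases zmod_two_cases b with rfl | rfl
    · exact congrFun h0 y
    · exact congrFun h1 y

/-- If one half vanishes, the other equals the sum of the halves and keeps the full `i`. If neither
does, each contributes at least `2^(i-1)`. -/
theorem SubcubeSumsVanish.two_pow_le {n i : ℕ} {f : (Fin n → ZMod 2) → ℝ}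
    (hf : SubcubeSumsVanish i f) (hne : f ≠ 0) : 2 ^ i ≤ (Function.support f).ncard := by
  induction n generalizing i with
  | zero =>
    obtain ⟨x, hx⟩ := Function.ne_iff.1 hne
    cases i with
    | zero =>
      exact Nat.succ_le_of_lt ((Set.ncard_pos (Set.toFinite _)).2 ⟨x, hx⟩)
    | succ i =>
      have := hf ∅ 0 (by simp)
      rw [Fintype.sum_eq_single x (fun y hy => absurd (Subsingleton.elim y x) hy)] at this
      simp at this
      exact absurd this hx
  | succ n ih =>
    rw [ncard_support_cube_succ]
    have hadd := hf.halves_add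
    by_cases h0 : (fun y => f (Fin.cons 0 y)) = 0
    · have h1 : (fun y => f (Fin.cons 1 y)) ≠ 0 := fun h1 => hne (fun_eq_zero_of_halves h0 h1)
      have e : (fun y => f (Fin.cons 0 y) + f (Fin.cons 1 y)) = fun y => f (Fin.cons 1 y) := by
        funext y
        simp [show f (Fin.cons 0 y) = 0 from congrFun h0 y]
      exact (ih (e ▸ hadd) h1).trans (Nat.le_add_left _ _)
    by_cases h1 : (fun y => f (Fin.cons 1 y)) = 0
    · have e : (fun y => f (Fin.cons 0 y) + f (Fin.cons 1 y)) = fun y => f (Fin.cons 0 y) := by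
        funext y
        simp [show f (Fin.cons 1 y) = 0 from congrFun h1 y]
      exact (ih (e ▸ hadd) h0).trans (Nat.le_add_right _ _)
    cases i with
    | zero =>
      have := ih (i := 0) (f := fun y => f (Fin.cons 0 y)) (fun S v h => absurd h (by simp)) h0
      omega
    | succ i =>
      have a0 := ih (hf.half 0) h0
      have a1 := ih (hf.half 1) h1
      rw [pow_succ]
      omega

/-! ### Alternating functions on block points, and prepending a coordinate. -/

/-- The point of `ℤ₂ⁿ` whose coordinates in the block `k` of the partial partition `p` are all
equal to `ε k`, and whose coordinates outside the blocks vanish. -/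
def blockPoint {n : ℕ} {κ : Type*} (p : Fin n → Option κ) (ε : κ → ZMod 2) (t : Fin n) : ZMod 2 :=
  (p t).elim 0 ε

/-- The function `f` is, up to a translation by `a` and the factor `c`, the alternating function on
the points which are constant on each block of `p`. -/
structure IsAlternatingOn {n i : ℕ} (f : (Fin n → ZMod 2) → ℝ) (a : Fin n → ZMod 2)
    (p : Fin n → Option (Fin i)) (c : ℝ) : Prop where
  ne_zero : c ≠ 0
  block_nonempty : ∀ k, ∃ t, p t = some k
  apply_eq : ∀ ε, f (a + blockPoint p ε) = c * ∏ k, bitSign (ε k)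
  exists_eq : ∀ x, f x ≠ 0 → ∃ ε, x = a + blockPoint p ε

theorem cons_add_blockPoint_cons {n : ℕ} {κ : Type*} (b : ZMod 2) (a : Fin n → ZMod 2)
    (o : Option κ) (p : Fin n → Option κ) (ε : κ → ZMod 2) :
    (Fin.cons b a + blockPoint (Fin.cons o p : Fin (n + 1) → Option κ) ε : Fin (n + 1) → ZMod 2) =
      Fin.cons (b + o.elim 0 ε) (a + blockPoint p ε) := by
  funext t
  induction t using Fin.cases <;> simp [blockPoint]

theorem IsAlternatingOn.cons_none {n i : ℕ} {f : (Fin (n + 1) → ZMod 2) → ℝ} {b : ZMod 2}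
    {a : Fin n → ZMod 2} {p : Fin n → Option (Fin i)} {c : ℝ}
    (h : IsAlternatingOn (fun y => f (Fin.cons b y)) a p c)
    (hf : ∀ d y, d ≠ b → f (Fin.cons d y) = 0) :
    IsAlternatingOn f (Fin.cons b a) (Fin.cons none p) c where
  ne_zero := h.ne_zero
  block_nonempty k := by
    obtain ⟨t, ht⟩ := h.block_nonempty k
    exact ⟨t.succ, ht⟩
  apply_eq ε := by
    rw [cons_add_blockPoint_cons, ← h.apply_eq ε]
    simp
  exists_eq x hx := by
    induction x using Fin.consCases with
    | _ d y =>
      obtain rfl : d = b := by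
        by_contra hd
        exact hx (hf d y hd)
      obtain ⟨ε, rfl⟩ := h.exists_eq y hx
      exact ⟨ε, by rw [cons_add_blockPoint_cons]; simp⟩

theorem IsAlternatingOn.cons_new {n i : ℕ} {f : (Fin (n + 1) → ZMod 2) → ℝ}
    {a : Fin n → ZMod 2} {p : Fin n → Option (Fin i)} {c : ℝ}
    (h : IsAlternatingOn (fun y => f (Fin.cons 0 y)) a p c)
    (hf : ∀ b y, f (Fin.cons b y) = bitSign b * f (Fin.cons 0 y)) :
    IsAlternatingOn f (Fin.cons 0 a)
      (Fin.cons (some 0) fun t => (p t).map Fin.succ : Fin (n + 1) → Option (Fin (i + 1))) c where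
  ne_zero := h.ne_zero
  block_nonempty k := by
    induction k using Fin.cases with
    | zero => exact ⟨0, rfl⟩
    | succ k =>
      obtain ⟨t, ht⟩ := h.block_nonempty k
      exact ⟨t.succ, by simp [ht]⟩
  apply_eq ε := by
    have e : blockPoint (fun t => (p t).map Fin.succ) ε = blockPoint p (fun k => ε k.succ) := by
      funext t
      cases ht : p t <;> simp [blockPoint, ht]
    rw [cons_add_blockPoint_cons, e, hf, h.apply_eq, Fin.prod_univ_succ]
    simp only [Option.elim_some, zero_add]
    ring
  exists_eq x hx := by
    induction x using Fin.consCases with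
    | _ b y =>
      rw [hf] at hx
      obtain ⟨ε, rfl⟩ := h.exists_eq y (right_ne_zero_of_mul hx)
      refine ⟨Fin.cons b ε, ?_⟩
      rw [cons_add_blockPoint_cons]
      congr 1
      · simp
      · congr 1
        funext t
        cases ht : p t <;> simp [blockPoint, ht]

/-- The prepended coordinate joins the existing block `k`, with `v` as its translation. In the
application `g` is the sum of the two halves of `f`. -/
theorem IsAlternatingOn.cons_extend {n i : ℕ} {f : (Fin (n + 1) → ZMod 2) → ℝ}
    {g : (Fin n → ZMod 2) → ℝ}
    {a : Fin n → ZMod 2} {p : Fin n → Option (Fin i)} {c : ℝ} (h : IsAlternatingOn g a p c)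
    (k : Fin i) (v : ZMod 2)
    (hg : ∀ b y, f (Fin.cons b y) ≠ 0 → g y ≠ 0)
    (hf : ∀ b ε, f (Fin.cons b (a + blockPoint p ε)) =
      if b = v + ε k then g (a + blockPoint p ε) else 0) :
    IsAlternatingOn f (Fin.cons v a) (Fin.cons (some k) p) c where
  ne_zero := h.ne_zero
  block_nonempty k := by
    obtain ⟨t, ht⟩ := h.block_nonempty k
    exact ⟨t.succ, ht⟩
  apply_eq ε := by
    rw [cons_add_blockPoint_cons, hf]
    simp [h.apply_eq]
  exists_eq x hx := by
    induction x using Fin.consCases with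
    | _ b y =>
      obtain ⟨ε, rfl⟩ := h.exists_eq y (hg b y hx)
      refine ⟨ε, ?_⟩
      rw [cons_add_blockPoint_cons]
      rw [hf] at hx
      have : b = v + ε k := by
        by_contra hb
        simp [hb] at hx
      rw [this]
      rfl

/-! ### The equality case. -/

/-- Fixing the values of some blocks amounts to fixing one representative coordinate in each,
because `f` vanishes away from the block points. -/
theorem SubcubeSumsVanish.comp_blockPoint {n m i : ℕ} {f : (Fin n → ZMod 2) → ℝ}
    (hf : SubcubeSumsVanish i f) {a : Fin n → ZMod 2} {p : Fin n → Option (Fin m)}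
    (hp : ∀ k, ∃ t, p t = some k) (hs : ∀ x, f x ≠ 0 → ∃ ε, x = a + blockPoint p ε) :
    SubcubeSumsVanish i (fun ε => f (a + blockPoint p ε)) := by
  choose t ht using hp
  intro S v hS
  have hval : ∀ ε k, (a + blockPoint p ε) (t k) = a (t k) + ε k := by
    intro ε k
    simp [blockPoint, ht]
  refine Eq.trans ?_ (hf (S.image t) (a + blockPoint p v) (Finset.card_image_le.trans_lt hS))
  refine Finset.sum_of_injOn (fun ε => a + blockPoint p ε) ?_ (fun _ _ => Finset.mem_coe.2
    (Finset.mem_univ _)) ?_ ?_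
  · intro ε _ δ _ h
    funext k
    have := congrFun h (t k)
    simp only [hval] at this
    exact add_left_cancel this
  · intro x _ hx
    by_contra hne
    have : f x ≠ 0 := fun h0 => hne (by simp [h0])
    obtain ⟨ε, rfl⟩ := hs x this
    exact hx ⟨ε, by simp, rfl⟩
  · intro ε _
    simp only [Finset.mem_image, forall_exists_index, and_imp, forall_apply_eq_imp_iff₂, hval,
      add_right_inj]

/-- A two-dimensional face has codimension `m - 2`, which is less than `i`. -/
theorem SubcubeSumsVanish.sum_face {m i : ℕ} {f : (Fin m → ZMod 2) → ℝ}
    (hf : SubcubeSumsVanish i f) (hm : m ≤ i + 1) {k l : Fin m} (hkl : k ≠ l)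
    (ε : Fin m → ZMod 2) :
    f ε + f (ε + Pi.single l 1) + (f (ε + Pi.single k 1) +
      f (ε + Pi.single k 1 + Pi.single l 1)) = 0 := by
  have hcard : ((Finset.univ.erase k).erase l).card < i := by
    rw [Finset.card_erase_of_mem (by simp [hkl.symm]), Finset.card_erase_of_mem (by simp)]
    have h1 : 1 < m := by
      have := k.2; have := l.2
      have : (k : ℕ) ≠ l := fun h => hkl (Fin.ext h)
      omega
    simp only [Finset.card_univ, Fintype.card_fin]
    omega
  have := hf _ ε hcard
  rw [← Finset.sum_filter] at this
  refine Eq.trans ?_ this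
  have hsum : ∀ F : ZMod 2 × ZMod 2 → ℝ, ∑ b, F b = F (0, 0) + F (0, 1) + (F (1, 0) + F (1, 1)) := by
    intro F
    rw [Fintype.sum_prod_type]
    exact (Fin.sum_univ_two (fun x : Fin 2 => ∑ y : ZMod 2, F (x, y))).trans
      (congrArg₂ (· + ·) (Fin.sum_univ_two fun y : Fin 2 => F ((0 : ZMod 2), y))
        (Fin.sum_univ_two fun y : Fin 2 => F ((1 : ZMod 2), y)))
  have h4 := hsum fun b => f (ε + Pi.single k b.1 + Pi.single l b.2)
  simp only [Pi.single_zero, add_zero] at h4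
  rw [← h4]
  refine Finset.sum_nbij' (fun b => ε + Pi.single k b.1 + Pi.single l b.2)
    (fun x => (x k - ε k, x l - ε l)) ?_ ?_ ?_ ?_ ?_
  · intro b _
    simp only [Finset.mem_filter, Finset.mem_univ, true_and, Finset.mem_erase, and_true]
    rintro s ⟨hsl, hsk⟩
    simp [hsl, hsk]
  · intro x _
    exact Finset.mem_univ _
  · rintro ⟨b, c⟩ _
    simp [hkl, hkl.symm]
  · intro x hx
    simp only [Finset.mem_filter, Finset.mem_univ, true_and, Finset.mem_erase, and_true] at hx
    funext s
    by_cases hsk : s = k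
    · subst hsk
      simp [hkl]
    by_cases hsl : s = l
    · subst hsl
      simp [hkl.symm]
    simp [hsk, hsl, hx s ⟨hsl, hsk⟩]
  · intro b _
    rfl

/-- A non-constant Boolean function of degree at most one depends on a single coordinate. -/
theorem exists_eq_ite_of_mixed_difference_eq_zero {m : ℕ} {β : (Fin m → ZMod 2) → ℝ}
    (hβ : ∀ ε, β ε = 0 ∨ β ε = 1)
    (hd : ∀ k l, k ≠ l → ∀ ε, β ε - β (ε + Pi.single l 1) =
      β (ε + Pi.single k 1) - β (ε + Pi.single k 1 + Pi.single l 1))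
    (h0 : ∃ ε, β ε ≠ 0) (h1 : ∃ ε, β ε ≠ 1) :
    ∃ k v, ∀ ε, β ε = if v = ε k then 1 else 0 := by
  obtain ⟨ε₀, l, hl⟩ : ∃ ε l, β (ε + Pi.single l 1) ≠ β ε := by
    by_contra! hcon
    obtain ⟨ε, hε⟩ := h0
    obtain ⟨δ, hδ⟩ := h1
    have hε' := (hβ ε).resolve_left hε
    have hδ' := (hβ δ).resolve_right hδ
    rw [eq_of_invariant_add_single hcon] at hε' hδ'
    rw [hε'] at hδ'
    exact one_ne_zero hδ'
  have hss : ∀ ε : Fin m → ZMod 2, ε + Pi.single l 1 + Pi.single l 1 = ε := by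
    intro ε
    have h11 : (1 + 1 : ZMod 2) = 0 := by decide
    rw [add_assoc, ← Pi.single_add, h11, Pi.single_zero, add_zero]
  -- The derivative in direction `l`, corrected by the sign of `ε l`, is constant: in direction `l`
  -- both factors change sign, in the others `hd` applies.
  have hconst := eq_of_invariant_add_single
    (h := fun ε => bitSign (ε l) * (β ε - β (ε + Pi.single l 1))) (by
      intro ε k
      by_cases hk : k = l
      · subst hk
        simp only [hss, Pi.add_apply, Pi.single_eq_same, bitSign_add, bitSign_one]
        ring
      · simp only [Pi.add_apply, Pi.single_eq_of_ne (Ne.symm hk), add_zero, ← hd k l hk])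
  generalize bitSign ((0 : Fin m → ZMod 2) l) * (β 0 - β (0 + Pi.single l 1)) = d at hconst
  have hdiff : ∀ ε, β ε - β (ε + Pi.single l 1) = bitSign (ε l) * d := by
    intro ε
    rw [← hconst ε, ← mul_assoc, bitSign_mul_self, one_mul]
  have hd1 : d = 1 ∨ d = -1 := by
    have h := hdiff ε₀
    have h' : β ε₀ - β (ε₀ + Pi.single l 1) ≠ 0 := sub_ne_zero.2 hl.symm
    rcases hβ ε₀ with e | e <;> rcases hβ (ε₀ + Pi.single l 1) with e' | e' <;>
      rcases zmod_two_cases (ε₀ l) with z | z <;>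
      simp only [e, e', z, bitSign_zero, bitSign_one] at h h' <;>
      first
      | exact absurd (sub_self _) h'
      | (left; linarith)
      | (right; linarith)
  have hv : ∃ v : ZMod 2, d = bitSign v := by
    rcases hd1 with h | h
    · exact ⟨0, by simp [h]⟩
    · exact ⟨1, by simp [h]⟩
  obtain ⟨v, rfl⟩ := hv
  refine ⟨l, v, fun ε => ?_⟩
  have h := hdiff ε
  rcases zmod_two_cases v with rfl | rfl <;> rcases zmod_two_cases (ε l) with z | z <;>
    rcases hβ ε with e | e <;> rcases hβ (ε + Pi.single l 1) with e' | e' <;>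
    simp only [e, e', z, bitSign_zero, bitSign_one] at h ⊢ <;>
    first
    | (norm_num; done)
    | (exfalso; norm_num at h)

/-- Coordinate `0` has three possible roles. If one half vanishes, it lies outside all blocks. If
the halves are opposite, it forms a new block. Otherwise the halves have disjoint supports, their
sum is alternating by induction, and coordinate `0` joins one of its blocks. -/
theorem SubcubeSumsVanish.exists_isAlternatingOn {n i : ℕ} {f : (Fin n → ZMod 2) → ℝ}
    (hf : SubcubeSumsVanish i f) (hcard : (Function.support f).ncard = 2 ^ i) :
    ∃ a p c, IsAlternatingOn (i := i) f a p c := by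
  induction n generalizing i with
  | zero =>
    have hne : f ≠ 0 := by
      rintro rfl
      rw [Function.support_zero, Set.ncard_empty] at hcard
      exact pow_ne_zero i two_ne_zero hcard.symm
    have hi : i = 0 := by
      by_contra hi
      have := hf ∅ 0 (by simpa using Nat.pos_of_ne_zero hi)
      rw [Fintype.sum_eq_single 0 (fun y hy => absurd (Subsingleton.elim y 0) hy)] at this
      simp only [Finset.notMem_empty, implies_true, if_true] at this
      refine hne (funext fun x => ?_)
      rw [Subsingleton.elim x 0, this]
      rfl
    subst hi
    refine ⟨0, fun _ => none, f 0, ?_, fun k => k.elim0, fun ε => ?_, fun x _ => ⟨0, ?_⟩⟩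
    · intro h
      refine hne (funext fun x => ?_)
      rw [Subsingleton.elim x 0, h]
      rfl
    · rw [Subsingleton.elim (0 + _) 0]
      simp
    · exact Subsingleton.elim _ _
  | succ n ih =>
    have hadd := hf.halves_add
    rw [ncard_support_cube_succ] at hcard
    by_cases h0 : (fun y => f (Fin.cons 0 y)) = 0
    · have e : (fun y => f (Fin.cons 0 y) + f (Fin.cons 1 y)) = fun y => f (Fin.cons 1 y) := by
        funext y
        simp [show f (Fin.cons 0 y) = 0 from congrFun h0 y]
      rw [h0] at hcard
      obtain ⟨a, p, c, h⟩ := ih (e ▸ hadd) (by simpa using hcard)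
      refine ⟨_, _, _, h.cons_none fun d y hd => ?_⟩
      rcases zmod_two_cases d with rfl | rfl
      · exact congrFun h0 y
      · exact absurd rfl hd
    by_cases h1 : (fun y => f (Fin.cons 1 y)) = 0
    · have e : (fun y => f (Fin.cons 0 y) + f (Fin.cons 1 y)) = fun y => f (Fin.cons 0 y) := by
        funext y
        simp [show f (Fin.cons 1 y) = 0 from congrFun h1 y]
      rw [h1] at hcard
      obtain ⟨a, p, c, h⟩ := ih (e ▸ hadd) (by simpa using hcard)
      refine ⟨_, _, _, h.cons_none fun d y hd => ?_⟩
      rcases zmod_two_cases d with rfl | rfl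
      · exact absurd rfl hd
      · exact congrFun h1 y
    cases i with
    | zero =>
      have a0 := SubcubeSumsVanish.two_pow_le (i := 0) (f := fun y => f (Fin.cons 0 y))
        (fun S v h => absurd h (by simp)) h0
      have a1 := SubcubeSumsVanish.two_pow_le (i := 0) (f := fun y => f (Fin.cons 1 y))
        (fun S v h => absurd h (by simp)) h1
      omega
    | succ i =>
      have a0 := (hf.half 0).two_pow_le h0
      have a1 := (hf.half 1).two_pow_le h1
      rw [pow_succ] at hcard
      by_cases hg : (fun y => f (Fin.cons 0 y) + f (Fin.cons 1 y)) = 0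
      · obtain ⟨a, p, c, h⟩ := ih (hf.half 0) (by omega)
        refine ⟨_, _, _, h.cons_new fun b y => ?_⟩
        have := congrFun hg y
        simp only [Pi.zero_apply] at this
        rcases zmod_two_cases b with rfl | rfl
        · simp
        · rw [bitSign_one]
          linarith
      · have hle := hadd.two_pow_le hg
        have hsub : (Function.support fun y => f (Fin.cons 0 y) + f (Fin.cons 1 y)) ⊆
            (Function.support fun y => f (Fin.cons 0 y)) ∪
              (Function.support fun y => f (Fin.cons 1 y)) :=
          Function.support_add _ _
        have hle' := Set.ncard_le_ncard hsub (Set.toFinite _)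
        have hui := Set.ncard_union_add_ncard_inter
          (Function.support fun y => f (Fin.cons 0 y))
          (Function.support fun y => f (Fin.cons 1 y)) (Set.toFinite _) (Set.toFinite _)
        -- The sum of the halves already needs `2^(i+1)` support points, the total available in
        -- both, so no point is shared.
        rw [pow_succ] at hle
        have hinter := (Set.ncard_eq_zero (Set.toFinite _)).1
          (show ((Function.support fun y => f (Fin.cons 0 y)) ∩
            (Function.support fun y => f (Fin.cons 1 y))).ncard = 0 by omega)
        have hdisj : ∀ y, f (Fin.cons 0 y) = 0 ∨ f (Fin.cons 1 y) = 0 := by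
          intro y
          by_contra! hcon
          exact Set.eq_empty_iff_forall_notMem.1 hinter y hcon
        obtain ⟨a, p, c, h⟩ := ih hadd (by rw [pow_succ]; omega)
        have hne : ∀ b y, f (Fin.cons b y) ≠ 0 → f (Fin.cons 0 y) + f (Fin.cons 1 y) ≠ 0 := by
          intro b y hb
          rcases zmod_two_cases b with rfl | rfl
          · rw [(hdisj y).resolve_left hb, add_zero]
            exact hb
          · rw [(hdisj y).resolve_right hb, zero_add]
            exact hb
        let s : (Fin (i + 1) → ZMod 2) → ℝ := fun ε => ∏ k, bitSign (ε k)
        have hs : ∀ ε k, s (ε + Pi.single k 1) = -s ε := fun ε k => cubeParity_add_single ε k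
        have hsn : ∀ ε, s ε ≠ 0 := fun ε => cubeParity_ne_zero ε
        -- `β` is the indicator of the block points that lie in half `0`. Dividing by the
        -- alternating sign turns vanishing face sums into vanishing mixed differences.
        let β : (Fin (i + 1) → ZMod 2) → ℝ :=
          fun ε => f (Fin.cons 0 (a + blockPoint p ε)) / (c * s ε)
        have hface := fun (k l : Fin (i + 1)) (hkl : k ≠ l) => ((hf.half 0).comp_blockPoint h.block_nonempty
          fun x hx => h.exists_eq x (hne 0 x hx)).sum_face le_rfl hkl
        have happ : ∀ ε, f (Fin.cons 0 (a + blockPoint p ε)) +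
            f (Fin.cons 1 (a + blockPoint p ε)) = c * s ε := h.apply_eq
        have hcs : ∀ ε, c * s ε ≠ 0 := fun ε => mul_ne_zero h.ne_zero (hsn ε)
        have hβ : ∀ ε, β ε = 0 ∨ β ε = 1 := by
          intro ε
          rcases hdisj (a + blockPoint p ε) with hz | hz
          · left
            simp [β, hz]
          · right
            have := happ ε
            rw [hz, add_zero] at this
            simp only [β, this]
            exact div_self (hcs ε)
        have hβf : ∀ ε, f (Fin.cons 0 (a + blockPoint p ε)) = β ε * (c * s ε) :=
          fun ε => (div_mul_cancel₀ _ (hcs ε)).symm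
        -- Half `0` has order `i` on a block cube of dimension `i + 1`, just enough for its face
        -- sums to vanish; `β` is not constant since both halves are nonzero.
        obtain ⟨k, v, hkv⟩ := exists_eq_ite_of_mixed_difference_eq_zero hβ (by
            intro k l hkl ε
            have := hface k l hkl ε
            simp only [hβf, hs] at this
            have h' : (β ε - β (ε + Pi.single l 1) - (β (ε + Pi.single k 1) -
                β (ε + Pi.single k 1 + Pi.single l 1))) * (c * s ε) = 0 := by
              linarith
            exact sub_eq_zero.1 ((mul_eq_zero.1 h').resolve_right (hcs ε)))
          (by
            obtain ⟨y, hy⟩ := Function.ne_iff.1 h0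
            obtain ⟨ε, rfl⟩ := h.exists_eq y (hne 0 y hy)
            exact ⟨ε, fun hz => hy (by simp [hβf, hz])⟩)
          (by
            obtain ⟨y, hy⟩ := Function.ne_iff.1 h1
            obtain ⟨ε, rfl⟩ := h.exists_eq y (hne 1 y hy)
            refine ⟨ε, fun hz => hy ?_⟩
            have := happ ε
            rw [hβf, hz] at this
            simp only [Pi.zero_apply]
            linarith)
        refine ⟨_, _, _, h.cons_extend k v hne fun b ε => ?_⟩
        have hb : ∀ b v w : ZMod 2, b = v + w ↔ (b = 0 ↔ v = w) := by decide
        have e1 := happ ε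
        have e0 := hβf ε
        rw [hkv] at e0
        simp only [hb b v, e1]
        by_cases hvk : v = ε k
        · rw [if_pos hvk, one_mul] at e0
          rcases zmod_two_cases b with rfl | rfl
          · simp [hvk, e0]
          · simp only [hvk, one_ne_zero, iff_true, if_false]
            linarith
        · rw [if_neg hvk, zero_mul] at e0
          rcases zmod_two_cases b with rfl | rfl
          · simp [hvk, e0]
          · simp only [hvk, one_ne_zero, if_true]
            linarith

/-! ### Tensor products as signed block functions, and matching of blocks. -/

/-- The function `f` is the alternating function, with signs running over the blocks in `K`, on the
points which are constant on each block of `p`. -/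
structure IsSignedBlock {n : ℕ} {κ : Type*} (f : (Fin n → ZMod 2) → ℝ) (p : Fin n → Option κ)
    (K : Finset κ) : Prop where
  mem : ∀ t k, p t = some k → k ∈ K
  apply_eq : ∀ ε, f (blockPoint p ε) = ∏ k ∈ K, bitSign (ε k)
  exists_eq : ∀ x, f x ≠ 0 → ∃ ε, x = blockPoint p ε

theorem blockPoint_congr {n : ℕ} {κ : Type*} {p : Fin n → Option κ} {K : Finset κ}
    (hp : ∀ t k, p t = some k → k ∈ K) {ε δ : κ → ZMod 2} (h : ∀ k ∈ K, ε k = δ k) :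
    blockPoint p ε = blockPoint p δ := by
  funext t
  cases ht : p t with
  | none => simp [blockPoint, ht]
  | some k => simpa [blockPoint, ht] using h k (hp t k ht)

theorem IsSignedBlock.tensor {m n : ℕ} {κ : Type*} [DecidableEq κ]
    {f : (Fin m → ZMod 2) → ℝ} {g : (Fin n → ZMod 2) → ℝ} {p : Fin m → Option κ}
    {q : Fin n → Option κ} {K L : Finset κ} (hf : IsSignedBlock f p K) (hg : IsSignedBlock g q L)
    (hKL : Disjoint K L) : IsSignedBlock (cubeTensor f g) (Fin.append p q) (K ∪ L) where
  mem t k ht := by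
    induction t using Fin.addCases with
    | left t =>
      rw [Fin.append_left] at ht
      exact Finset.mem_union_left _ (hf.mem t k ht)
    | right t =>
      rw [Fin.append_right] at ht
      exact Finset.mem_union_right _ (hg.mem t k ht)
  apply_eq ε := by
    have e1 : (fun t => blockPoint (Fin.append p q) ε (Fin.castAdd n t)) = blockPoint p ε := by
      funext t; simp [blockPoint]
    have e2 : (fun t => blockPoint (Fin.append p q) ε (Fin.natAdd m t)) = blockPoint q ε := by
      funext t; simp [blockPoint]
    rw [cubeTensor, e1, e2, hf.apply_eq, hg.apply_eq, Finset.prod_union hKL]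
  exists_eq x hx := by
    obtain ⟨ε, hε⟩ := hf.exists_eq _ (left_ne_zero_of_mul hx)
    obtain ⟨δ, hδ⟩ := hg.exists_eq _ (right_ne_zero_of_mul hx)
    -- The two assignments glue because the label sets are disjoint.
    refine ⟨fun k => if k ∈ K then ε k else δ k, ?_⟩
    rw [blockPoint_congr hf.mem (δ := fun k => if k ∈ K then ε k else δ k)
      (fun k hk => by simp [hk])] at hε
    rw [blockPoint_congr hg.mem (δ := fun k => if k ∈ K then ε k else δ k)
      (fun k hk => by simp [Finset.disjoint_right.1 hKL hk])] at hδ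
    funext t
    induction t using Fin.addCases with
    | left t =>
      rw [congrFun hε t]
      simp [blockPoint]
    | right t =>
      rw [congrFun hδ t]
      simp [blockPoint]

theorem card_fiber_append {m n : ℕ} {α : Type*} [DecidableEq α] (p : Fin m → α) (q : Fin n → α)
    (o : α) : (Finset.univ.filter fun t => Fin.append p q t = o).card =
      (Finset.univ.filter fun t => p t = o).card + (Finset.univ.filter fun t => q t = o).card := by
  simp only [Finset.card_filter, Fin.sum_univ_add, Fin.append_left, Fin.append_right]

theorem isSignedBlock_cubePhi {m : ℕ} (hm : 0 < m) {κ : Type*} (k : κ) :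
    IsSignedBlock (cubePhi m) (fun _ => some k) {k} where
  mem t l h := by simpa [eq_comm] using h
  apply_eq ε := by
    have h10 : (fun _ : Fin m => (1 : ZMod 2)) ≠ 0 := fun h => by
      simpa using congrFun h ⟨0, hm⟩
    have e : blockPoint (fun _ : Fin m => some k) ε = fun _ => ε k := rfl
    rw [e, Finset.prod_singleton, cubePhi]
    rcases zmod_two_cases (ε k) with h | h <;> rw [h]
    · rw [if_pos (by rfl), bitSign_zero]
    · rw [if_neg h10, if_pos (by rfl), bitSign_one]
  exists_eq x hx := by
    rw [cubePhi] at hx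
    split_ifs at hx with h0 h1
    · exact ⟨0, h0⟩
    · exact ⟨1, h1⟩
    · exact absurd rfl hx

theorem isSignedBlock_cubeI (m : ℕ) (κ : Type*) :
    IsSignedBlock (cubeI m) (fun _ => (none : Option κ)) ∅ where
  mem t l h := by simp at h
  apply_eq ε := by
    have e : blockPoint (fun _ : Fin m => (none : Option κ)) ε = 0 := rfl
    simp [e, cubeI]
  exists_eq x hx := by
    rw [cubeI] at hx
    split_ifs at hx with h0
    · exact ⟨0, h0⟩
    · exact absurd rfl hx

/-- The list carries labels rather than sizes, so that blocks of equal size stay distinct. -/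
theorem exists_isSignedBlock_cubeTensorList {κ : Type*} [DecidableEq κ] (w : κ → ℕ)
    (hw : ∀ k, 0 < w k) (L : List κ) (hL : L.Nodup) :
    ∃ q : Fin (L.map w).sum → Option κ,
      IsSignedBlock (cubeTensorList cubePhi (L.map w)) q L.toFinset ∧
      (∀ k, (Finset.univ.filter fun t => q t = some k).card = if k ∈ L then w k else 0) ∧
      (Finset.univ.filter fun t => q t = none).card = 0 := by
  induction L with
  | nil =>
    refine ⟨fun _ => none, ⟨fun t => t.elim0, fun ε => ?_, fun x _ => ⟨0, ?_⟩⟩, fun k => ?_, ?_⟩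
    · rw [List.toFinset_nil, Finset.prod_empty]
      rfl
    · funext t
      exact t.elim0
    · simp
    · rfl
  | cons a L ih =>
    obtain ⟨ha, hL⟩ := List.nodup_cons.1 hL
    obtain ⟨q, hq, hs, hn⟩ := ih hL
    refine ⟨Fin.append (fun _ : Fin (w a) => some a) q, ?_, fun k => ?_, ?_⟩
    · rw [List.toFinset_cons, Finset.insert_eq]
      exact (isSignedBlock_cubePhi (hw a) a).tensor hq (by simpa using ha)
    · refine (card_fiber_append _ q _).trans ?_
      rw [hs]
      by_cases hk : k = a
      · subst hk
        simp [ha]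
      · simp [hk, Ne.symm hk]
    · refine (card_fiber_append _ q _).trans ?_
      rw [hn]
      simp

theorem IsSignedBlock.cast {m n : ℕ} (h : n = m) {κ : Type*} {f : (Fin m → ZMod 2) → ℝ}
    {p : Fin m → Option κ} {K : Finset κ} (hf : IsSignedBlock f p K) :
    IsSignedBlock (cubeCast h f) (fun t => p (Fin.cast h t)) K := by
  subst h
  exact hf

theorem card_fiber_cast {m n : ℕ} (h : n = m) {α : Type*} [DecidableEq α] (p : Fin m → α) (o : α) :
    (Finset.univ.filter fun t => p (Fin.cast h t) = o).card =
      (Finset.univ.filter fun t => p t = o).card := by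
  subst h
  rfl

theorem exists_perm_of_card_fiber_eq {ι α : Type*} [Fintype ι] [DecidableEq α] {p q : ι → α}
    (h : ∀ o, (Finset.univ.filter fun t => p t = o).card =
      (Finset.univ.filter fun t => q t = o).card) : ∃ σ : Equiv.Perm ι, ∀ t, q (σ t) = p t := by
  let e : ∀ o, {t // p t = o} ≃ {t // q t = o} := fun o =>
    Fintype.equivOfCardEq (by simpa only [Fintype.card_subtype] using h o)
  refine ⟨(Equiv.sigmaFiberEquiv p).symm.trans
    ((Equiv.sigmaCongrRight e).trans (Equiv.sigmaFiberEquiv q)), fun t => ?_⟩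
  exact (e (p t) ⟨t, rfl⟩).2

/-- The automorphism of the hypercube permuting the coordinates by `σ` and translating by `a`. -/
def hypercubeIso {n : ℕ} (a : Fin n → ZMod 2) (σ : Equiv.Perm (Fin n)) :
    hypercube n ≃g hypercube n where
  toEquiv := (Equiv.arrowCongr σ.symm (Equiv.refl _)).trans (Equiv.addLeft a)
  map_rel_iff' := by
    intro x y
    change hammingDist (a + x ∘ σ) (a + y ∘ σ) = 1 ↔ hammingDist x y = 1
    have : hammingDist (a + x ∘ σ) (a + y ∘ σ) = hammingDist x y := by
      refine Finset.card_equiv σ fun t => ?_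
      simp
    rw [this]

/-- Equal block sizes give a coordinate permutation matching the blocks; followed by translation by
`a`, it carries the block points of `q` to the support of `f` with signs preserved. -/
theorem IsAlternatingOn.cubeEquivalent {n i : ℕ} {f g : (Fin n → ZMod 2) → ℝ}
    {a : Fin n → ZMod 2} {p q : Fin n → Option (Fin i)} {c : ℝ} (hf : IsAlternatingOn f a p c)
    (hg : IsSignedBlock g q Finset.univ)
    (h : ∀ o, (Finset.univ.filter fun t => p t = o).card =
      (Finset.univ.filter fun t => q t = o).card) : CubeEquivalent f g := by
  obtain ⟨σ, hσ⟩ := exists_perm_of_card_fiber_eq h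
  have hπ : ∀ x t, hypercubeIso a σ x t = a t + x (σ t) := fun x t => rfl
  have hblock : ∀ ε, hypercubeIso a σ (blockPoint q ε) = a + blockPoint p ε := by
    intro ε
    funext t
    simp [hπ, blockPoint, hσ]
  have key : ∀ ε, g (blockPoint q ε) = c⁻¹ * f (hypercubeIso a σ (blockPoint q ε)) := by
    intro ε
    rw [hblock, hf.apply_eq, hg.apply_eq, inv_mul_cancel_left₀ hf.ne_zero]
  refine ⟨hypercubeIso a σ, c⁻¹, inv_ne_zero hf.ne_zero, fun x => ?_⟩
  by_cases hx : ∃ ε, x = blockPoint q ε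
  · obtain ⟨ε, rfl⟩ := hx
    exact key ε
  · have h1 : g x = 0 := by
      by_contra h1
      exact hx (hg.exists_eq x h1)
    have h2 : f (hypercubeIso a σ x) = 0 := by
      by_contra h2
      obtain ⟨ε, hε⟩ := hf.exists_eq _ h2
      rw [← hblock] at hε
      exact hx ⟨ε, (hypercubeIso a σ).injective hε⟩
    rw [h1, h2, mul_zero]

theorem IsAlternatingOn.exists_cubeEquivalent_cubeTensor {n i : ℕ} {f : (Fin n → ZMod 2) → ℝ}
    {a : Fin n → ZMod 2} {p : Fin n → Option (Fin i)} {c : ℝ} (hf : IsAlternatingOn f a p c) :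
    ∃ (ns ms : List ℕ) (r : ℕ) (h : n = ns.sum + ms.sum + r),
      (∀ a ∈ ns, Odd a) ∧ (∀ b ∈ ms, Even b ∧ 0 < b) ∧ ns.length + ms.length = i ∧
      CubeEquivalent f (cubeCast h
        (cubeTensor (cubeTensor (cubeTensorList cubePhi ns) (cubeTensorList cubePhi ms))
          (cubeI r))) := by
  let w : Fin i → ℕ := fun k => (Finset.univ.filter fun t => p t = some k).card
  have hw : ∀ k, 0 < w k := by
    intro k
    obtain ⟨t, ht⟩ := hf.block_nonempty k
    exact Finset.card_pos.2 ⟨t, by simpa using ht⟩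
  -- The blocks are split by the parity of their size; the coordinates outside all blocks supply
  -- `r`.
  let A := Finset.univ.filter fun k => Odd (w k)
  let B := Finset.univ.filter fun k => ¬ Odd (w k)
  obtain ⟨q₁, hq₁, hs₁, hn₁⟩ :=
    exists_isSignedBlock_cubeTensorList w hw A.toList A.nodup_toList
  obtain ⟨q₂, hq₂, hs₂, hn₂⟩ :=
    exists_isSignedBlock_cubeTensorList w hw B.toList B.nodup_toList
  rw [Finset.toList_toFinset] at hq₁ hq₂
  have hAB : Disjoint A B := Finset.disjoint_filter_filter_not _ _ _
  have hU : A ∪ B = Finset.univ := Finset.filter_union_filter_not_eq _ _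
  have hn : n = (A.toList.map w).sum + (B.toList.map w).sum +
      (Finset.univ.filter fun t => p t = none).card := by
    rw [Finset.sum_map_toList, Finset.sum_map_toList, ← Finset.sum_union hAB, hU, add_comm,
      ← Fintype.sum_option (fun o => (Finset.univ.filter fun t => p t = o).card),
      ← Finset.card_eq_sum_card_fiberwise (fun _ _ => Finset.mem_coe.2 (Finset.mem_univ _)),
      Finset.card_univ, Fintype.card_fin]
  refine ⟨A.toList.map w, B.toList.map w, _, hn, ?_, ?_, ?_, ?_⟩
  · intro b hb
    obtain ⟨k, hk, rfl⟩ := List.mem_map.1 hb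
    exact (Finset.mem_filter.1 (Finset.mem_toList.1 hk)).2
  · intro b hb
    obtain ⟨k, hk, rfl⟩ := List.mem_map.1 hb
    exact ⟨Nat.not_odd_iff_even.1 (Finset.mem_filter.1 (Finset.mem_toList.1 hk)).2, hw k⟩
  · rw [List.length_map, List.length_map, Finset.length_toList, Finset.length_toList,
      ← Finset.card_union_of_disjoint hAB, hU, Finset.card_univ, Fintype.card_fin]
  · have hg := ((hq₁.tensor hq₂ hAB).tensor (isSignedBlock_cubeI _ _) (by simp)).cast hn
    rw [hU, Finset.union_empty] at hg
    refine hf.cubeEquivalent hg fun o => ?_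
    rw [card_fiber_cast hn, card_fiber_append, card_fiber_append]
    cases o with
    | none =>
      rw [hn₁, hn₂]
      simp
    | some k =>
      rw [hs₁, hs₂]
      by_cases hk : Odd (w k)
      · simp [A, B, hk, w]
      · simp [A, B, hk, w]

/-! ### Support sizes and invariance under equivalence. -/

theorem ncard_support_cubeTensor {m n : ℕ} (f : (Fin m → ZMod 2) → ℝ) (g : (Fin n → ZMod 2) → ℝ) :
    (Function.support (cubeTensor f g)).ncard =
      (Function.support f).ncard * (Function.support g).ncard := by
  have h : Function.support (cubeTensor f g) =
      Fin.appendEquiv m n '' (Function.support f ×ˢ Function.support g) := by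
    ext x
    obtain ⟨⟨y, z⟩, rfl⟩ := (Fin.appendEquiv m n).surjective x
    simp [cubeTensor]
  rw [h, Set.ncard_image_of_injective _ (Fin.appendEquiv m n).injective, Set.ncard_prod]

theorem ncard_support_cubeTensorList {F : (k : ℕ) → (Fin k → ZMod 2) → ℝ} {L : List ℕ}
    (hF : ∀ k ∈ L, (Function.support (F k)).ncard = 2) :
    (Function.support (cubeTensorList F L)).ncard = 2 ^ L.length := by
  induction L with
  | nil =>
    change (Function.support fun _ : Fin 0 → ZMod 2 => (1 : ℝ)).ncard = 1
    rw [Function.support_const one_ne_zero, Set.ncard_univ, Nat.card_unique]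
  | cons a L ih =>
    refine (ncard_support_cubeTensor (F a) (cubeTensorList F L)).trans ?_
    rw [hF a (by simp), ih fun k hk => hF k (by simp [hk]), List.length_cons, pow_succ, mul_comm]

theorem zero_ne_one_cube {k : ℕ} (hk : 0 < k) : (0 : Fin k → ZMod 2) ≠ 1 := fun h => by
  simpa using congrFun h ⟨0, hk⟩

theorem ncard_support_cubePhi {k : ℕ} (hk : 0 < k) : (Function.support (cubePhi k)).ncard = 2 := by
  refine Eq.trans (congrArg Set.ncard ?_) (Set.ncard_pair (zero_ne_one_cube hk))
  ext x
  simp only [Function.mem_support, cubePhi, Set.mem_insert_iff, Set.mem_singleton_iff]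
  split_ifs with h0 h1 <;> simp [*]

theorem ncard_support_cubePsi {k : ℕ} (hk : 0 < k) : (Function.support (cubePsi k)).ncard = 2 := by
  refine Eq.trans (congrArg Set.ncard ?_) (Set.ncard_pair (zero_ne_one_cube hk))
  ext x
  simp only [Function.mem_support, cubePsi, Set.mem_insert_iff, Set.mem_singleton_iff]
  split_ifs with h0 h1 <;> simp [*]

theorem ncard_support_cubeI (k : ℕ) : (Function.support (cubeI k)).ncard = 1 := by
  rw [← Set.ncard_singleton (0 : Fin k → ZMod 2)]
  congr 1
  ext x
  simp [cubeI]

theorem ncard_support_cubeCast {m n : ℕ} (h : n = m) (f : (Fin m → ZMod 2) → ℝ) :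
    (Function.support (cubeCast h f)).ncard = (Function.support f).ncard := by
  subst h
  rfl

theorem CubeEquivalent.ncard_support_eq {n : ℕ} {f g : (Fin n → ZMod 2) → ℝ}
    (h : CubeEquivalent f g) : (Function.support f).ncard = (Function.support g).ncard := by
  obtain ⟨π, c, hc, hg⟩ := h
  have : Function.support f = π '' Function.support g := by
    ext x
    obtain ⟨y, rfl⟩ := π.surjective x
    simp [hg, hc]
  rw [this, Set.ncard_image_of_injective _ π.injective]

theorem CubeEquivalent.mem_cubeEigenspaceIcc {n i j : ℕ} {f g : (Fin n → ZMod 2) → ℝ}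
    (h : CubeEquivalent f g) (hf : f ∈ cubeEigenspaceIcc n i j) : g ∈ cubeEigenspaceIcc n i j := by
  obtain ⟨π, c, -, hg⟩ := h
  have : g = c • fun x => f (π x) := by
    funext x
    simp [hg]
  rw [this]
  exact Submodule.smul_mem _ _ (comp_iso_mem_cubeEigenspaceIcc hf π)

/-! ### Fourier coefficients of large weight and the bound on even blocks. -/

/-- The function `f` has a nonzero Fourier coefficient of weight `w`. -/
def HasCubeCoeff {n : ℕ} (f : (Fin n → ZMod 2) → ℝ) (w : ℕ) : Prop :=
  ∃ T : Finset (Fin n), T.card = w ∧ ∑ x, f x * cubeChar T x ≠ 0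

theorem HasCubeCoeff.tensor {m n v w : ℕ} {f : (Fin m → ZMod 2) → ℝ} {g : (Fin n → ZMod 2) → ℝ}
    (hf : HasCubeCoeff f v) (hg : HasCubeCoeff g w) : HasCubeCoeff (cubeTensor f g) (v + w) := by
  obtain ⟨S, rfl, hS⟩ := hf
  obtain ⟨T, rfl, hT⟩ := hg
  refine ⟨(S.disjSum T).map finSumFinEquiv.toEmbedding, by simp, ?_⟩
  have : ∑ x, cubeTensor f g x * cubeChar ((S.disjSum T).map finSumFinEquiv.toEmbedding) x =
      (∑ x, f x * cubeChar S x) * ∑ x, g x * cubeChar T x := by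
    rw [← Equiv.sum_comp (Fin.appendEquiv m n), Fintype.sum_prod_type, Finset.sum_mul_sum]
    refine Finset.sum_congr rfl fun x _ => Finset.sum_congr rfl fun y _ => ?_
    simp [cubeTensor, cubeChar, Finset.prod_disjSum]
    ring
  rw [this]
  exact mul_ne_zero hS hT

/-- For odd `w` the coefficient is `1 - (-1)^w = 2`. -/
theorem hasCubeCoeff_cubePhi {k w : ℕ} (hw : Odd w) (hwk : w ≤ k) : HasCubeCoeff (cubePhi k) w := by
  obtain ⟨T, -, hT⟩ := Finset.exists_subset_card_eq (s := (Finset.univ : Finset (Fin k))) (n := w)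
    (by simpa using hwk)
  refine ⟨T, hT, ?_⟩
  have hk : 0 < k := hw.pos.trans_le hwk
  have h : ∀ x, cubePhi k x * cubeChar T x =
      (if x = 0 then 1 else 0) + (if x = 1 then 1 else 0) := by
    intro x
    rw [cubePhi]
    by_cases h0 : x = 0
    · subst h0
      simp [cubeChar, zero_ne_one_cube hk]
    by_cases h1 : x = 1
    · subst h1
      simp [cubeChar, (zero_ne_one_cube hk).symm, hT, hw.neg_one_pow]
    simp [h0, h1]
  simp only [h, Finset.sum_add_distrib, Finset.sum_ite_eq', Finset.mem_univ, if_true]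
  norm_num

theorem hasCubeCoeff_cubeI (k : ℕ) : HasCubeCoeff (cubeI k) k := by
  refine ⟨Finset.univ, by simp, ?_⟩
  simp [cubeI, cubeChar]

theorem hasCubeCoeff_cubeTensorList {F : (k : ℕ) → (Fin k → ZMod 2) → ℝ} {L : List ℕ} {w : ℕ → ℕ}
    (hF : ∀ k ∈ L, HasCubeCoeff (F k) (w k)) :
    HasCubeCoeff (cubeTensorList F L) (L.map w).sum := by
  induction L with
  | nil =>
    refine ⟨∅, rfl, ?_⟩
    change ∑ x : Fin 0 → ZMod 2, (1 : ℝ) * cubeChar ∅ x ≠ 0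
    simp [cubeChar]
  | cons a L ih =>
    exact (hF a (by simp)).tensor (ih fun k hk => hF k (by simp [hk]))

theorem HasCubeCoeff.cast {m n w : ℕ} (h : n = m) {f : (Fin m → ZMod 2) → ℝ}
    (hf : HasCubeCoeff f w) : HasCubeCoeff (cubeCast h f) w := by
  subst h
  exact hf

theorem HasCubeCoeff.le_of_mem {n i j w : ℕ} {f : (Fin n → ZMod 2) → ℝ} (h : HasCubeCoeff f w)
    (hf : f ∈ cubeEigenspaceIcc n i j) : w ≤ j := by
  obtain ⟨T, rfl, hT⟩ := h
  by_contra hlt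
  exact hT (sum_mul_cubeChar_eq_zero_of_mem_Icc hf (Or.inr (not_le.1 hlt)))

theorem sum_map_pred_add_length {L : List ℕ} (hL : ∀ a ∈ L, 0 < a) :
    (L.map fun a => a - 1).sum + L.length = L.sum := by
  induction L with
  | nil => rfl
  | cons a L ih =>
    have := ih fun b hb => hL b (by simp [hb])
    have := hL a (by simp)
    simp only [List.map_cons, List.sum_cons, List.length_cons]
    omega

theorem exists_cubeTensor_cubePhi_of_ncard_support_eq {n i j : ℕ} {f : (Fin n → ZMod 2) → ℝ}
    (hf : f ∈ cubeEigenspaceIcc n i j) (hcard : (Function.support f).ncard = 2 ^ i) :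
    ∃ (ns ms : List ℕ) (r : ℕ) (h : n = ns.sum + ms.sum + r),
      (∀ a ∈ ns, Odd a) ∧ (∀ b ∈ ms, Even b ∧ 0 < b) ∧
      ns.length + ms.length = i ∧ n - j ≤ ms.length ∧
      CubeEquivalent f (cubeCast h
        (cubeTensor (cubeTensor (cubeTensorList cubePhi ns) (cubeTensorList cubePhi ms))
          (cubeI r))) := by
  obtain ⟨a, p, c, h⟩ :=
    (subcubeSumsVanish_of_mem_cubeEigenspaceIcc hf).exists_isAlternatingOn hcard
  obtain ⟨ns, ms, r, hn, hns, hms, hlen, heq⟩ := h.exists_cubeEquivalent_cubeTensor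
  refine ⟨ns, ms, r, hn, hns, hms, hlen, ?_, heq⟩
  have h1 : HasCubeCoeff (cubeTensorList cubePhi ns) (ns.map id).sum :=
    hasCubeCoeff_cubeTensorList fun k hk => hasCubeCoeff_cubePhi (hns k hk) le_rfl
  have h2 : HasCubeCoeff (cubeTensorList cubePhi ms) (ms.map fun a => a - 1).sum :=
    hasCubeCoeff_cubeTensorList fun k hk =>
      hasCubeCoeff_cubePhi (Nat.Even.sub_odd (hms k hk).2 (hms k hk).1 odd_one) (Nat.sub_le _ _)
  -- The weight found is `n` minus the number of even blocks, since each of these loses exactly one.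
  have hle := (((h1.tensor h2).tensor (hasCubeCoeff_cubeI r)).cast hn).le_of_mem
    (heq.mem_cubeEigenspaceIcc hf)
  have hsum := sum_map_pred_add_length fun a ha => (hms a ha).2
  rw [List.map_id] at hle
  omega

theorem ncard_support_eq_of_cubeEquivalent_cubeTensor {n : ℕ} {f : (Fin n → ZMod 2) → ℝ}
    {F G : (k : ℕ) → (Fin k → ZMod 2) → ℝ} {ns ms : List ℕ} {r : ℕ} (h : n = ns.sum + ms.sum + r)
    (hF : ∀ k ∈ ns, (Function.support (F k)).ncard = 2)
    (hG : ∀ k ∈ ms, (Function.support (G k)).ncard = 2)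
    (heq : CubeEquivalent f (cubeCast h
        (cubeTensor (cubeTensor (cubeTensorList F ns) (cubeTensorList G ms)) (cubeI r)))) :
    (Function.support f).ncard = 2 ^ (ns.length + ms.length) := by
  rw [heq.ncard_support_eq, ncard_support_cubeCast, ncard_support_cubeTensor,
    ncard_support_cubeTensor, ncard_support_cubeTensorList hF, ncard_support_cubeTensorList hG,
    ncard_support_cubeI, mul_one, pow_add]

/-! ### The parity twist of the model functions, and the second statement. -/

theorem cubeParity_mul_cubeTensor {m n : ℕ} (f : (Fin m → ZMod 2) → ℝ) (g : (Fin n → ZMod 2) → ℝ) :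
    (fun x => cubeParity x * cubeTensor f g x) =
      cubeTensor (fun x => cubeParity x * f x) (fun x => cubeParity x * g x) := by
  funext x
  simp only [cubeTensor, cubeParity, Fin.prod_univ_add]
  ring

theorem cubeParity_mul_cubeTensorList {F G : (k : ℕ) → (Fin k → ZMod 2) → ℝ} {L : List ℕ}
    (h : ∀ k ∈ L, (fun x => cubeParity x * F k x) = G k) :
    (fun x => cubeParity x * cubeTensorList F L x) = cubeTensorList G L := by
  induction L with
  | nil =>
    funext x
    exact mul_one (1 : ℝ)
  | cons a L ih =>
    refine (cubeParity_mul_cubeTensor (F a) (cubeTensorList F L)).trans ?_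
    rw [h a (by simp), ih fun k hk => h k (by simp [hk])]
    rfl

theorem cubeParity_mul_cubePhi_of_odd {k : ℕ} (hk : Odd k) :
    (fun x => cubeParity x * cubePhi k x) = cubePsi k := by
  funext x
  rw [cubePhi, cubePsi]
  split_ifs with h0 h1
  · simp [h0, cubeParity]
  · simp [h1, cubeParity, hk.neg_one_pow]
  · simp

theorem cubeParity_mul_cubePhi_of_even {k : ℕ} (hk : Even k) :
    (fun x => cubeParity x * cubePhi k x) = cubePhi k := by
  funext x
  rw [cubePhi]
  split_ifs with h0 h1
  · simp [h0, cubeParity]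
  · simp [h1, cubeParity, hk.neg_one_pow]
  · simp

theorem cubeParity_mul_cubeI (k : ℕ) : (fun x => cubeParity x * cubeI k x) = cubeI k := by
  funext x
  rw [cubeI]
  split_ifs with h0
  · simp [h0, cubeParity]
  · simp

theorem cubeParity_mul_cubeCast {m n : ℕ} (h : n = m) (f : (Fin m → ZMod 2) → ℝ) :
    (fun x => cubeParity x * cubeCast h f x) = cubeCast h fun x => cubeParity x * f x := by
  subst h
  rfl

/-- Parity composed with an automorphism is parity up to a global sign, absorbed into the constant.
-/
theorem CubeEquivalent.of_cubeParity_mul {n : ℕ} {f g : (Fin n → ZMod 2) → ℝ}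
    (h : CubeEquivalent (fun x => cubeParity x * f x) g) :
    CubeEquivalent f (fun x => cubeParity x * g x) := by
  obtain ⟨π, c, hc, hg⟩ := h
  refine ⟨π, c * cubeParity (π 0), mul_ne_zero hc (cubeParity_ne_zero _), fun x => ?_⟩
  simp only [hg, ← cubeParity_mul_iso π x]
  ring

theorem ncard_support_cubeParity_mul {n : ℕ} (f : (Fin n → ZMod 2) → ℝ) :
    (Function.support fun x => cubeParity x * f x).ncard = (Function.support f).ncard := by
  congr 1
  ext x
  simp [cubeParity_ne_zero]

theorem exists_cubeTensor_cubePsi_of_ncard_support_eq {n i j : ℕ} (hij : i ≤ j) (hjn : j ≤ n)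
    {f : (Fin n → ZMod 2) → ℝ}
    (hf : f ∈ cubeEigenspaceIcc n i j) (hcard : (Function.support f).ncard = 2 ^ (n - j)) :
    ∃ (ns ms : List ℕ) (r : ℕ) (h : n = ns.sum + ms.sum + r),
      (∀ a ∈ ns, Odd a) ∧ (∀ b ∈ ms, Even b ∧ 0 < b) ∧
      ns.length + ms.length = n - j ∧ i ≤ ms.length ∧
      CubeEquivalent f (cubeCast h
        (cubeTensor (cubeTensor (cubeTensorList cubePsi ns) (cubeTensorList cubePhi ms))
          (cubeI r))) := by
  obtain ⟨ns, ms, r, hn, hns, hms, hlen, hle, heq⟩ := exists_cubeTensor_cubePhi_of_ncard_support_eq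
    (cubeParity_mul_mem_cubeEigenspaceIcc hjn hf) ((ncard_support_cubeParity_mul f).trans hcard)
  -- For the twisted function the upper end is `n - i`, so the bound reads `n - (n - i) = i`, using
  -- `i ≤ n`.
  refine ⟨ns, ms, r, hn, hns, hms, hlen, by omega, ?_⟩
  have := heq.of_cubeParity_mul
  rwa [cubeParity_mul_cubeCast, cubeParity_mul_cubeTensor, cubeParity_mul_cubeTensor,
    cubeParity_mul_cubeI,
    cubeParity_mul_cubeTensorList fun k hk => cubeParity_mul_cubePhi_of_odd (hns k hk),
    cubeParity_mul_cubeTensorList fun k hk => cubeParity_mul_cubePhi_of_even (hms k hk).1] at this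

/-! ### The characterisation. -/

theorem mainTheorem1 (n i j : ℕ) (hij : i ≤ j) (hjn : j ≤ n)
    (f : (Fin n → ZMod 2) → ℝ) (hf : f ∈ cubeEigenspaceIcc n i j) :
    (n ≤ i + j →
      ((Function.support f).ncard = 2 ^ i ↔
        ∃ (ns ms : List ℕ) (r : ℕ) (h : n = ns.sum + ms.sum + r),
          (∀ a ∈ ns, Odd a) ∧ (∀ b ∈ ms, Even b ∧ 0 < b) ∧
          ns.length + ms.length = i ∧ n - j ≤ ms.length ∧
          CubeEquivalent f (cubeCast h
            (cubeTensor (cubeTensor (cubeTensorList cubePhi ns) (cubeTensorList cubePhi ms))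
              (cubeI r))))) ∧
    (i + j ≤ n →
      ((Function.support f).ncard = 2 ^ (n - j) ↔
        ∃ (ns ms : List ℕ) (r : ℕ) (h : n = ns.sum + ms.sum + r),
          (∀ a ∈ ns, Odd a) ∧ (∀ b ∈ ms, Even b ∧ 0 < b) ∧
          ns.length + ms.length = n - j ∧ i ≤ ms.length ∧
          CubeEquivalent f (cubeCast h
            (cubeTensor (cubeTensor (cubeTensorList cubePsi ns) (cubeTensorList cubePhi ms))
              (cubeI r))))) := by
  refine ⟨fun _ => ⟨exists_cubeTensor_cubePhi_of_ncard_support_eq hf, ?_⟩,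
    fun _ => ⟨exists_cubeTensor_cubePsi_of_ncard_support_eq hij hjn hf, ?_⟩⟩
  · rintro ⟨ns, ms, r, h, hns, hms, hlen, -, heq⟩
    rw [← hlen]
    exact ncard_support_eq_of_cubeEquivalent_cubeTensor h
      (fun k hk => ncard_support_cubePhi (hns k hk).pos)
      (fun k hk => ncard_support_cubePhi (hms k hk).2) heq
  · rintro ⟨ns, ms, r, h, hns, hms, hlen, -, heq⟩
    rw [← hlen]
    exact ncard_support_eq_of_cubeEquivalent_cubeTensor h
      (fun k hk => ncard_support_cubePsi (hns k hk).pos)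
      (fun k hk => ncard_support_cubePhi (hms k hk).2) heq
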